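/- Let $\mathfrak{L}$ be a left Leibniz algebra over a field $\mathbb{F}$ of characteristic zero, i.e. an $\mathbb{F}$-vector space with a bilinear multiplication satisfying $x(yz)=(xy)z+y(xz)$ for all $x,y,z\in\mathfrak{L}$. Let $\mathrm{Leib}(\mathfrak{L})$ be the subspace spanned by all squares $x^2=xx$ with $x\in\mathfrak{L}$, and let $\mathfrak{L}^2$ be the subspace spanned by all products $xy$ with $x,y\in\mathfrak{L}$. Call $\mathfrak{L}$ simple if $0$, $\mathrm{Leib}(\mathfrak{L})$ and $\mathfrak{L}$ are its only two-sided ideals and $\mathrm{Leib}(\mathfrak{L})\subsetneq\mathfrak{L}^2$. Then the following statements are equivalent: (i) $\mathfrak{L}$ is finite-dimensional and simple. (ii) There is a finite-dimensional subalgebra $\mathfrak{g}$ of $\mathfrak{L}$ that is a simple Lie algebra, such that $\mathfrak{L}=\mathfrak{g}\oplus\mathrm{Leib}(\mathfrak{L})$ as vector spaces, and either $\mathrm{Leib}(\mathfrak{L})=0$ or $\mathrm{Leib}(\mathfrak{L})$ is a non-trivial finite-dimensional irreducible anti-symmetric $\mathfrak{g}$-bimodule under left and right multiplication in $\mathfrak{L}$.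 (A bimodule is trivial if both its left and its right action are zero, anti-symmetric if its right action is zero, and irreducible if it is non-zero and $0$ and itself are its only subbimodules.) (iii) $\mathfrak{L}$ is a finite-dimensional simple Lie algebra, or there are a finite-dimensional simple Lie algebra $\mathfrak{g}$ over $\mathbb{F}$ and a finite-dimensional irreducible left $\mathfrak{g}$-module $M$ with non-zero action such that $\mathfrak{L}$ is isomorphic to the left hemi-semidirect product $\mathfrak{g}\ltimes_\ell M$, i.e. the vector space $\mathfrak{g}\times M$ with the multiplication $(g,m)(g',m')=([g,g'],\,g\cdot m')$. -/

import Mathlib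

universe u v

namespace LeibnizAlg

/-! An *algebra* over `F` (bilinear multiplication, no further identities) is a
`NonUnitalNonAssocRing L` with `Module F L`, `IsScalarTower F L L` and `SMulCommClass F L L`. -/

/-- The left Leibniz identity: every left multiplication operator is a derivation. -/
class IsLeftLeibniz (L : Type*) [NonUnitalNonAssocRing L] : Prop where
  leibniz : ∀ x y z : L, x * (y * z) = (x * y) * z + y * (x * z)

/-- A two-sided ideal of an algebra over `F`: a subspace that absorbs the multiplication on both
sides. -/
def IsIdeal {F L : Type*} [Field F] [NonUnitalNonAssocRing L] [Module F L]
    (I : Submodule F L) : Prop :=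
  ∀ x : L, ∀ a ∈ I, x * a ∈ I ∧ a * x ∈ I

/-- The Leibniz kernel `Leib(L)`: the subspace spanned by all squares. -/
def leib (F L : Type*) [Field F] [NonUnitalNonAssocRing L] [Module F L] : Submodule F L :=
  Submodule.span F (Set.range fun x : L => x * x)

/-- The derived subalgebra `L²`: the subspace spanned by all products. -/
def derived (F L : Type*) [Field F] [NonUnitalNonAssocRing L] [Module F L] : Submodule F L :=
  Submodule.span F (Set.range fun p : L × L => p.1 * p.2)

/-- A left Leibniz algebra is simple if `0`, `Leib(L)` and `L` are its only ideals and `Leib(L)` is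
properly contained in `L²`. -/
structure IsSimple (F L : Type*) [Field F] [NonUnitalNonAssocRing L] [Module F L] : Prop where
  ideals : ∀ I : Submodule F L, IsIdeal I → I = ⊥ ∨ I = leib F L ∨ I = ⊤
  leib_lt_derived : leib F L < derived F L

section Lie

/-- A left Leibniz algebra in which all squares vanish is a Lie ring, with its multiplication
as the bracket. -/
abbrev lieRingOfSq {L : Type*} [NonUnitalNonAssocRing L] [IsLeftLeibniz L]
    (h : ∀ x : L, x * x = 0) : LieRing L where
  bracket x y := x * y
  add_lie x y z := add_mul x y z
  lie_add x y z := mul_add x y z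
  lie_self x := h x
  leibniz_lie x y z := IsLeftLeibniz.leibniz x y z

/-- A left Leibniz algebra in which all squares vanish is a Lie algebra, with its multiplication
as the bracket. -/
abbrev lieAlgebraOfSq (F : Type*) {L : Type*} [Field F] [NonUnitalNonAssocRing L] [Module F L]
    [SMulCommClass F L L] [IsLeftLeibniz L] (h : ∀ x : L, x * x = 0) :
    @LieAlgebra F L _ (lieRingOfSq h) :=
  letI := lieRingOfSq h
  { (inferInstance : Module F L) with
    lie_smul := fun t x y => mul_smul_comm t x y }

/-- The left Leibniz algebra `L` is a Lie algebra (all squares vanish), and as such it is simple. -/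
def IsSimpleLie (F L : Type*) [Field F] [NonUnitalNonAssocRing L] [Module F L]
    [SMulCommClass F L L] [IsLeftLeibniz L] : Prop :=
  ∃ h : ∀ x : L, x * x = 0, @LieAlgebra.IsSimple F L _ (lieRingOfSq h) (lieAlgebraOfSq F h)

end Lie

/-- A subalgebra of a left Leibniz algebra is a left Leibniz algebra. -/
instance {F L : Type*} [Field F] [NonUnitalNonAssocRing L] [Module F L] [IsLeftLeibniz L]
    (g : NonUnitalSubalgebra F L) : IsLeftLeibniz g where
  leibniz x y z := Subtype.ext (IsLeftLeibniz.leibniz (x : L) y z)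

section Bimodules

/-- A bimodule structure on the vector space `M` over the left Leibniz algebra `L`. Here
`left x m` is `x · m` and `right x m` is `m · x`. -/
structure Bimodule (F L M : Type*) [Field F] [NonUnitalNonAssocRing L] [Module F L]
    [AddCommGroup M] [Module F M] where
  left : L →ₗ[F] M →ₗ[F] M
  right : L →ₗ[F] M →ₗ[F] M
  /-- `(xy)·m = x·(y·m) - y·(x·m)` -/
  llm : ∀ x y m, left (x * y) m = left x (left y m) - left y (left x m)
  /-- `(x·m)·y = x·(m·y) - m·(xy)` -/
  lml : ∀ x y m, right y (left x m) = left x (right y m) - right (x * y) m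
  /-- `(m·x)·y = m·(xy) - x·(m·y)` -/
  mll : ∀ x y m, right y (right x m) = right (x * y) m - left x (right y m)

variable {F L M : Type*} [Field F] [NonUnitalNonAssocRing L] [Module F L]
  [AddCommGroup M] [Module F M]

/-- A subspace is a subbimodule if it is stable under the left and the right action. -/
def Bimodule.IsSubbimodule (B : Bimodule F L M) (N : Submodule F M) : Prop :=
  ∀ x : L, ∀ m ∈ N, B.left x m ∈ N ∧ B.right x m ∈ N

/-- An irreducible bimodule is non-zero and has no subbimodules besides `0` and itself. -/
def Bimodule.IsIrreducible (B : Bimodule F L M) : Prop :=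
  Nontrivial M ∧ ∀ N : Submodule F M, B.IsSubbimodule N → N = ⊥ ∨ N = ⊤

/-- A bimodule is trivial if both actions vanish. -/
def Bimodule.IsTrivial (B : Bimodule F L M) : Prop :=
  ∀ (x : L) (m : M), B.left x m = 0 ∧ B.right x m = 0

/-- A bimodule is anti-symmetric if the right action vanishes. -/
def Bimodule.IsAntisymmetric (B : Bimodule F L M) : Prop :=
  ∀ (x : L) (m : M), B.right x m = 0

end Bimodules

section Kernel

variable {F L : Type*} [Field F] [NonUnitalNonAssocRing L] [Module F L] [IsScalarTower F L L]
  [SMulCommClass F L L] [IsLeftLeibniz L]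

/-- The Leibniz kernel is a two-sided ideal. -/
theorem isIdeal_leib : IsIdeal (leib F L) := by
  intro x a ha
  have hsq : ∀ z : L, z * z ∈ leib F L := fun z => Submodule.subset_span ⟨z, rfl⟩
  refine ⟨?_, ?_⟩
  · induction ha using Submodule.span_induction with
    | mem a h =>
      obtain ⟨y, rfl⟩ := h
      have e : x * (y * y)
          = (x * y + y) * (x * y + y) - (x * y) * (x * y) - y * y := by
        rw [IsLeftLeibniz.leibniz x y y]
        simp only [add_mul, mul_add]
        abel
      change x * (y * y) ∈ leib F L
      rw [e]
      exact sub_mem (sub_mem (hsq _) (hsq _)) (hsq _)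
    | zero => simp
    | add a b _ _ h1 h2 => rw [mul_add]; exact add_mem h1 h2
    | smul c a _ h => rw [mul_smul_comm]; exact Submodule.smul_mem _ c h
  · induction ha using Submodule.span_induction with
    | mem a h =>
      obtain ⟨y, rfl⟩ := h
      have e : (y * y) * x = 0 := by
        simpa using IsLeftLeibniz.leibniz y y x
      change (y * y) * x ∈ leib F L
      rw [e]
      exact zero_mem _
    | zero => simp
    | add a b _ _ h1 h2 => rw [add_mul]; exact add_mem h1 h2
    | smul c a _ h => rw [smul_mul_assoc]; exact Submodule.smul_mem _ c h

/-- An ideal `I` of `L`, as a bimodule over a subalgebra `g` of `L` through the left and the right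
multiplication of `L`. -/
def idealBimodule (g : NonUnitalSubalgebra F L) (I : Submodule F L) (hI : IsIdeal I) :
    Bimodule F g I where
  left := LinearMap.mk₂ F (fun (x : g) (m : I) => (⟨(x : L) * m, (hI x m m.2).1⟩ : I))
    (fun x y m => Subtype.ext (add_mul (x : L) y m))
    (fun c x m => Subtype.ext (smul_mul_assoc c (x : L) (m : L)))
    (fun x m n => Subtype.ext (mul_add (x : L) m n))
    (fun c x m => Subtype.ext (mul_smul_comm c (x : L) (m : L)))
  right := LinearMap.mk₂ F (fun (x : g) (m : I) => (⟨(m : L) * x, (hI x m m.2).2⟩ : I))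
    (fun x y m => Subtype.ext (mul_add (m : L) x y))
    (fun c x m => Subtype.ext (mul_smul_comm c (m : L) (x : L)))
    (fun x m n => Subtype.ext (add_mul (m : L) n x))
    (fun c x m => Subtype.ext (smul_mul_assoc c (m : L) (x : L)))
  llm x y m := Subtype.ext (eq_sub_of_add_eq (IsLeftLeibniz.leibniz (x : L) y m).symm)
  lml x y m := Subtype.ext (eq_sub_of_add_eq (IsLeftLeibniz.leibniz (x : L) m y).symm)
  mll x y m := Subtype.ext (eq_sub_of_add_eq (IsLeftLeibniz.leibniz (m : L) x y).symm)

/-- `Leib(L)` as a bimodule over a subalgebra `g` of `L`. -/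
def leibBimodule (g : NonUnitalSubalgebra F L) : Bimodule F g (leib F L) :=
  idealBimodule g (leib F L) isIdeal_leib

end Kernel

section Hemi

/-- The underlying vector space `𝔤 × M` of the left hemi-semidirect product of a Lie algebra `𝔤`
and a left `𝔤`-module `M`. -/
def HemiSemidirect (𝔤 M : Type*) : Type _ := 𝔤 × M

variable {𝔤 M : Type*} [LieRing 𝔤] [AddCommGroup M]

instance : AddCommGroup (HemiSemidirect 𝔤 M) := inferInstanceAs (AddCommGroup (𝔤 × M))

instance {F : Type*} [Field F] [LieAlgebra F 𝔤] [Module F M] : Module F (HemiSemidirect 𝔤 M) :=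
  inferInstanceAs (Module F (𝔤 × M))

/-- `(g, m)(g', m') = ([g, g'], g · m')`. -/
instance [LieRingModule 𝔤 M] : Mul (HemiSemidirect 𝔤 M) where
  mul p q := ((⁅p.1, q.1⁆, ⁅p.1, q.2⁆) : 𝔤 × M)

theorem HemiSemidirect.mul_def [LieRingModule 𝔤 M] (p q : HemiSemidirect 𝔤 M) :
    p * q = ((⁅p.1, q.1⁆, ⁅p.1, q.2⁆) : 𝔤 × M) := rfl

instance [LieRingModule 𝔤 M] : NonUnitalNonAssocRing (HemiSemidirect 𝔤 M) where
  zero_mul p := by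
    change ((⁅(0 : 𝔤), p.1⁆, ⁅(0 : 𝔤), p.2⁆) : 𝔤 × M) = (0, 0)
    simp
  mul_zero p := by
    change ((⁅p.1, (0 : 𝔤)⁆, ⁅p.1, (0 : M)⁆) : 𝔤 × M) = (0, 0)
    simp
  left_distrib p q r := by
    change ((⁅p.1, q.1 + r.1⁆, ⁅p.1, q.2 + r.2⁆) : 𝔤 × M)
      = (⁅p.1, q.1⁆ + ⁅p.1, r.1⁆, ⁅p.1, q.2⁆ + ⁅p.1, r.2⁆)
    simp
  right_distrib p q r := by
    change ((⁅p.1 + q.1, r.1⁆, ⁅p.1 + q.1, r.2⁆) : 𝔤 × M)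
      = (⁅p.1, r.1⁆ + ⁅q.1, r.1⁆, ⁅p.1, r.2⁆ + ⁅q.1, r.2⁆)
    simp

/-- The left hemi-semidirect product is a left Leibniz algebra. -/
instance [LieRingModule 𝔤 M] : IsLeftLeibniz (HemiSemidirect 𝔤 M) where
  leibniz p q r := by
    change ((⁅p.1, ⁅q.1, r.1⁆⁆, ⁅p.1, ⁅q.1, r.2⁆⁆) : 𝔤 × M)
      = (⁅⁅p.1, q.1⁆, r.1⁆ + ⁅q.1, ⁅p.1, r.1⁆⁆, ⁅⁅p.1, q.1⁆, r.2⁆ + ⁅q.1, ⁅p.1, r.2⁆⁆)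
    rw [← leibniz_lie, ← leibniz_lie]

instance {F : Type*} [Field F] [LieAlgebra F 𝔤] [Module F M] [LieRingModule 𝔤 M]
    [LieModule F 𝔤 M] : IsScalarTower F (HemiSemidirect 𝔤 M) (HemiSemidirect 𝔤 M) where
  smul_assoc c p q := by
    change ((⁅c • p.1, q.1⁆, ⁅c • p.1, q.2⁆) : 𝔤 × M) = (c • ⁅p.1, q.1⁆, c • ⁅p.1, q.2⁆)
    simp

instance {F : Type*} [Field F] [LieAlgebra F 𝔤] [Module F M] [LieRingModule 𝔤 M]
    [LieModule F 𝔤 M] : SMulCommClass F (HemiSemidirect 𝔤 M) (HemiSemidirect 𝔤 M) where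
  smul_comm c p q := by
    change ((c • ⁅p.1, q.1⁆, c • ⁅p.1, q.2⁆) : 𝔤 × M) = (⁅p.1, c • q.1⁆, ⁅p.1, c • q.2⁆)
    simp

end Hemi

/-- Two algebras over `F` are isomorphic. -/
def IsIso (F A B : Type*) [Field F] [AddCommGroup A] [Module F A] [Mul A]
    [AddCommGroup B] [Module F B] [Mul B] : Prop :=
  ∃ e : A ≃ₗ[F] B, ∀ x y : A, e (x * y) = e x * e y

end LeibnizAlg

/-!
Since `Leib(L)` is spanned by squares and left multiplication is a derivation, `Leib(L) · L = 0`.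
Hence a complementary subalgebra `g` of `Leib(L)` makes `L` a hemi-semidirect product
(`exists_iso_hemiSemidirect`), and the two-sided ideals of `L` are governed by the ideals of `g` and
the submodules of `Leib(L)`. This gives the passage between the three descriptions
(`IsSimple.isSimpleLie_of_isCompl`, `IsSimple.leibBimodule_isIrreducible`,
`HemiSemidirect.isSimple`) once the complement exists.

The existence of the complement is the Levi-type statement `IsSimple.exists_isCompl_leib`. By the
Leibniz identity the left multiplications form a Lie algebra, which acts on `L`, and
`x ↦ (y ↦ x * y)` is a surjection of modules from `L` onto it. If `L` is simple, this Lie algebra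
is simple and the kernel of the surjection is `Leib(L)`. In characteristic zero the surjection
splits (`exists_lieModuleHom_section`, a case of Weyl's theorem), and the image of a section is a
subalgebra. Weyl's theorem in turn comes from Cartan's criterion, through the Casimir operator of
the trace form and its Fitting decomposition (`exists_invariant_notMem`).
-/

namespace LeibnizAlg

/-! ### Complete reducibility over a simple Lie algebra -/

section Weyl

open Module LieModule

variable {F 𝔤 : Type*} [Field F] [LieRing 𝔤] [LieAlgebra F 𝔤]

theorem derivedSeries_one_eq_top_of_isSimple [LieAlgebra.IsSimple F 𝔤] :
    LieAlgebra.derivedSeries F 𝔤 1 = ⊤ := by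
  refine (LieAlgebra.IsSimple.eq_bot_or_eq_top (R := F) _).resolve_left fun h => ?_
  refine LieAlgebra.IsSimple.non_abelian F (L := 𝔤) ⟨fun x y => ?_⟩
  have hxy : ⁅x, y⁆ ∈ LieAlgebra.derivedSeries F 𝔤 1 :=
    LieSubmodule.lie_mem_lie (LieSubmodule.mem_top x) (LieSubmodule.mem_top y)
  rwa [h, LieSubmodule.mem_bot] at hxy

variable {W : Type*} [AddCommGroup W] [Module F W] [LieRingModule 𝔤 W] [LieModule F 𝔤 W]

/-- As `𝔤 = [𝔤, 𝔤]` and `[y, z] · w = y · (z · w) - z · (y · w)`, the lower central series of any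
`𝔤`-module is constant from its first step on. -/
theorem isTrivial_of_isNilpotent_of_isSimple [LieAlgebra.IsSimple F 𝔤] [IsNilpotent 𝔤 W] :
    IsTrivial 𝔤 W := by
  have key (k : ℕ) : ∀ (x : 𝔤) (w : W), ⁅x, w⁆ ∈ lowerCentralSeries F 𝔤 W k := by
    induction k with
    | zero => simp
    | succ k ih =>
      intro x
      have hx : x ∈ (⁅(⊤ : LieIdeal F 𝔤), (⊤ : LieIdeal F 𝔤)⁆ : LieIdeal F 𝔤) := by
        rw [← LieAlgebra.derivedSeriesOfIdeal_zero (R := F) (L := 𝔤) ⊤,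
          ← LieAlgebra.derivedSeriesOfIdeal_succ]
        have h := derivedSeries_one_eq_top_of_isSimple (F := F) (𝔤 := 𝔤)
        exact h.ge (LieSubmodule.mem_top x)
      rw [← LieSubmodule.mem_toSubmodule, LieSubmodule.lieIdeal_oper_eq_linear_span'] at hx
      rw [LieModule.lowerCentralSeries_succ]
      induction hx using Submodule.span_induction with
      | mem x h =>
        obtain ⟨y, _, z, _, rfl⟩ := h
        intro w
        rw [lie_lie]
        exact sub_mem (LieSubmodule.lie_mem_lie (LieSubmodule.mem_top y) (ih z w))
          (LieSubmodule.lie_mem_lie (LieSubmodule.mem_top z) (ih y w))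
      | zero => simp
      | add x y _ _ hx hy => exact fun w => by rw [add_lie]; exact add_mem (hx w) (hy w)
      | smul c x _ hx => exact fun w => by rw [smul_lie]; exact Submodule.smul_mem _ c (hx w)
  obtain ⟨k, hk⟩ := (isNilpotent_iff F 𝔤 W).mp inferInstance
  exact ⟨fun x w => by simpa [hk] using key k x w⟩

/-- The radical of the trace form is an ideal of `𝔤`. Were it all of `𝔤`, Cartan's criterion would
make `𝔤 = [𝔤, 𝔤]` act nilpotently, hence trivially. -/
theorem traceForm_nondegenerate [CharZero F] [FiniteDimensional F 𝔤] [FiniteDimensional F W]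
    [LieAlgebra.IsSimple F 𝔤] (h : ¬ IsTrivial 𝔤 W) : (traceForm F 𝔤 W).Nondegenerate := by
  have hs : LinearMap.IsSymm (traceForm F 𝔤 W) := traceForm_isSymm F 𝔤 W
  let K := LieAlgebra.InvariantForm.orthogonal (traceForm F 𝔤 W) (traceForm_lieInvariant F 𝔤 W) ⊤
  have hK (y : 𝔤) : y ∈ K ↔ ∀ x, traceForm F 𝔤 W x y = 0 := by
    simp [K, LieAlgebra.InvariantForm.mem_orthogonal]
  rcases LieAlgebra.IsSimple.eq_bot_or_eq_top (R := F) K with hbot | htop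
  · refine hs.isRefl.nondegenerate_iff_separatingRight.mpr ?_
    intro y hy
    simpa [hbot] using (hK y).mpr hy
  · have h0 : traceForm F 𝔤 W = 0 := by
      ext x y
      exact (hK y).mp (htop ▸ LieSubmodule.mem_top y) x
    have hn := isNilpotent_derivedSeries_of_traceForm_eq_zero h0
    rw [derivedSeries_one_eq_top_of_isSimple] at hn
    have := (isNilpotent_of_top_iff (R := F)).mp hn
    exact absurd (isTrivial_of_isNilpotent_of_isSimple (F := F)) h

/-- The Casimir operator of the trace form: it commutes with the action, maps `W` into
every submodule that contains all `⁅x, w⁆`, and has trace `dim 𝔤`. -/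
theorem exists_casimir [FiniteDimensional F 𝔤]
    (h : (traceForm F 𝔤 W).Nondegenerate) : ∃ C : Module.End F W,
      (∀ (x : 𝔤) (w : W), C ⁅x, w⁆ = ⁅x, C w⁆) ∧
      (∀ V : LieSubmodule F 𝔤 W, (∀ (x : 𝔤) (w : W), ⁅x, w⁆ ∈ V) → ∀ w, C w ∈ V) ∧
      LinearMap.trace F W C = finrank F 𝔤 := by
  classical
  set B := traceForm F 𝔤 W with hB
  have hs : B.IsSymm := ⟨traceForm_comm F 𝔤 W⟩
  let b := finBasis F 𝔤
  let d := B.dualBasis h b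
  have hb (y : 𝔤) : y = ∑ j, B y (d j) • b j := by
    conv_lhs => rw [← b.sum_repr y]
    refine Finset.sum_congr rfl fun j _ => ?_
    rw [← B.dualBasis_repr_apply h, B.dualBasis_dualBasis h hs]
  have hd (y : 𝔤) : y = ∑ j, B y (b j) • d j := by
    conv_lhs => rw [← d.sum_repr y]
    exact Finset.sum_congr rfl fun j _ => by rw [B.dualBasis_repr_apply h]
  refine ⟨∑ i, toEnd F 𝔤 W (b i) ∘ₗ toEnd F 𝔤 W (d i), fun x w => ?_, fun V hV w => ?_, ?_⟩
  · have e1 (i) : ⁅⁅x, b i⁆, ⁅d i, w⁆⁆ = ∑ j, B ⁅x, b i⁆ (d j) • ⁅b j, ⁅d i, w⁆⁆ := by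
      conv_lhs => rw [hb ⁅x, b i⁆]
      rw [sum_lie]
      simp
    have e2 (i) : ⁅b i, ⁅⁅x, d i⁆, w⁆⁆ = ∑ j, B ⁅x, d i⁆ (b j) • ⁅b i, ⁅d j, w⁆⁆ := by
      conv_lhs => rw [hd ⁅x, d i⁆]
      rw [sum_lie, lie_sum]
      simp
    -- By invariance of `B`, the matrices of `ad x` in the dual bases `b` and `d` are negative
    -- transposes of each other.
    have e : ∑ i, (⁅⁅x, b i⁆, ⁅d i, w⁆⁆ + ⁅b i, ⁅⁅x, d i⁆, w⁆⁆) = 0 := by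
      simp only [e1, e2, Finset.sum_add_distrib]
      rw [Finset.sum_comm, ← Finset.sum_add_distrib]
      refine Finset.sum_eq_zero fun i _ => ?_
      rw [← Finset.sum_add_distrib]
      refine Finset.sum_eq_zero fun j _ => ?_
      rw [← add_smul, hB, traceForm_apply_lie_apply', traceForm_comm F 𝔤 W (b j), neg_add_cancel,
        zero_smul]
    have e3 : ⁅x, ∑ i, ⁅b i, ⁅d i, w⁆⁆⁆ - ∑ i, ⁅b i, ⁅d i, ⁅x, w⁆⁆⁆ = 0 := by
      rw [lie_sum, ← Finset.sum_sub_distrib, ← e]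
      refine Finset.sum_congr rfl fun i _ => ?_
      rw [leibniz_lie x (b i), leibniz_lie x (d i), lie_add]
      abel
    simpa using (sub_eq_zero.mp e3).symm
  · simp only [LinearMap.sum_apply, LinearMap.comp_apply, toEnd_apply_apply]
    exact sum_mem fun i _ => hV _ _
  · rw [map_sum]
    have this (i) : LinearMap.trace F W (toEnd F 𝔤 W (b i) ∘ₗ toEnd F 𝔤 W (d i)) = 1 := by
      rw [← traceForm_apply_apply, ← hB, B.apply_dualBasis_right h hs, if_pos rfl]
    simp [this]

/-- If `𝔤` maps `W` into a proper submodule `V`, there is an invariant vector outside `V`.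

When the action is non-trivial, the Casimir operator `C` is not nilpotent, since its trace `dim 𝔤`
is non-zero in characteristic zero. In the Fitting decomposition `W = ker Cᵏ ⊕ range Cᵏ` the second
summand lies in `V`, so the first does not, and it has smaller dimension than `W`. -/
theorem exists_invariant_notMem [CharZero F] [FiniteDimensional F 𝔤] [LieAlgebra.IsSimple F 𝔤]
    (n : ℕ) : ∀ (W : Type*) [AddCommGroup W] [Module F W] [LieRingModule 𝔤 W] [LieModule F 𝔤 W]
    [FiniteDimensional F W] (_ : finrank F W = n) (V : LieSubmodule F 𝔤 W)
    (_ : ∀ (x : 𝔤) (w : W), ⁅x, w⁆ ∈ V) (_ : V ≠ ⊤), ∃ w, w ∉ V ∧ ∀ x : 𝔤, ⁅x, w⁆ = 0 := by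
  induction n using Nat.strong_induction_on with
  | _ n ih =>
  intro W _ _ _ _ _ hn V hV hVT
  obtain ⟨w₀, hw₀⟩ : ∃ w, w ∉ V := by
    by_contra! h
    exact hVT (LieSubmodule.ext_iff.mpr fun m => by simp [h m])
  by_cases htriv : IsTrivial 𝔤 W
  · exact ⟨w₀, hw₀, fun x => htriv.trivial x w₀⟩
  obtain ⟨C, hC, hCV, htr⟩ := exists_casimir (traceForm_nondegenerate (F := F) htriv)
  obtain ⟨k, hk1, hk⟩ : ∃ k, 1 ≤ k ∧ IsCompl (LinearMap.ker (C ^ k)) (LinearMap.range (C ^ k)) := by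
    obtain ⟨k, hk⟩ := Filter.eventually_atTop.mp C.eventually_isCompl_ker_pow_range_pow
    exact ⟨max k 1, le_max_right _ _, hk _ (le_max_left _ _)⟩
  have hCk (x : 𝔤) (w : W) : (C ^ k) ⁅x, w⁆ = ⁅x, (C ^ k) w⁆ := by
    clear hk hk1
    induction k with
    | zero => simp
    | succ k ih => rw [pow_succ', Module.End.mul_apply, ih, hC, Module.End.mul_apply]
  let N : LieSubmodule F 𝔤 W :=
    { LinearMap.ker (C ^ k) with
      lie_mem := fun {x m} hm => by
        have hm : (C ^ k) m = 0 := hm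
        change (C ^ k) ⁅x, m⁆ = 0
        rw [hCk, hm, lie_zero] }
  have hNtop : N.toSubmodule ≠ ⊤ := by
    intro h
    have hker : LinearMap.ker (C ^ k) = ⊤ := h
    have hnil : IsNilpotent C := ⟨k, LinearMap.ker_eq_top.mp hker⟩
    have h0 := (LinearMap.isNilpotent_trace_of_isNilpotent hnil).eq_zero
    rw [htr] at h0
    have := LieAlgebra.IsSimple.nontrivial F (L := 𝔤)
    exact (finrank_pos (R := F) (M := 𝔤)).ne' (by exact_mod_cast h0)
  have hNV : ¬ N ≤ V := by
    intro h
    have : (⊤ : Submodule F W) ≤ V.toSubmodule := by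
      rw [← hk.sup_eq_top]
      refine sup_le h ?_
      rintro _ ⟨w, rfl⟩
      obtain ⟨j, rfl⟩ := Nat.exists_eq_add_of_le' hk1
      rw [pow_succ']
      exact hCV V hV _
    exact hw₀ (this trivial)
  obtain ⟨w, hw, hinv⟩ := ih (finrank F N.toSubmodule) (hn ▸ Submodule.finrank_lt hNtop) N rfl
    (V.comap N.incl) (fun x w => hV x w) (fun h => hNV fun m hm => by
      have : (⟨m, hm⟩ : N) ∈ V.comap N.incl := h ▸ LieSubmodule.mem_top _
      exact this)
  exact ⟨w, hw, fun x => congrArg Subtype.val (hinv x)⟩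

/-- A surjection of finite-dimensional modules over a simple Lie algebra splits. The `𝔤`-module of
linear maps `f : N → M` for which `π ∘ f` is a scalar is mapped by `𝔤` into the submodule of those
with `π ∘ f = 0`; an invariant vector outside the latter is, up to a scalar, the section. -/
theorem exists_lieModuleHom_section [CharZero F] [FiniteDimensional F 𝔤] [LieAlgebra.IsSimple F 𝔤]
    {M N : Type*} [AddCommGroup M] [Module F M] [LieRingModule 𝔤 M] [LieModule F 𝔤 M]
    [FiniteDimensional F M] [AddCommGroup N] [Module F N] [LieRingModule 𝔤 N] [LieModule F 𝔤 N]
    [FiniteDimensional F N] (π : M →ₗ⁅F,𝔤⁆ N) (hπ : Function.Surjective π) :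
    ∃ s : N →ₗ⁅F,𝔤⁆ M, ∀ n, π (s n) = n := by
  rcases subsingleton_or_nontrivial N with hN | hN
  · exact ⟨0, fun n => Subsingleton.elim _ _⟩
  have key (f : N →ₗ[F] M) (c : F) (hf : ∀ n, π (f n) = c • n) (x : 𝔤) (n : N) :
      π (⁅x, f⁆ n) = 0 := by
    rw [LieHom.lie_apply, map_sub, LieModuleHom.map_lie, hf, hf, lie_smul, sub_self]
  let W : LieSubmodule F 𝔤 (N →ₗ[F] M) :=
    { carrier := {f | ∃ c : F, ∀ n, π (f n) = c • n}
      add_mem' := by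
        rintro f g ⟨c, hc⟩ ⟨d, hd⟩
        exact ⟨c + d, fun n => by simp [hc, hd, add_smul]⟩
      zero_mem' := ⟨0, fun n => by simp⟩
      smul_mem' := by
        rintro a f ⟨c, hc⟩
        exact ⟨a * c, fun n => by simp [hc, mul_smul]⟩
      lie_mem := by
        rintro x f ⟨c, hc⟩
        exact ⟨0, fun n => by rw [key f c hc, zero_smul]⟩ }
  let V : LieSubmodule F 𝔤 (N →ₗ[F] M) :=
    { carrier := {f | ∀ n, π (f n) = 0}
      add_mem' := fun {f g} hf hg n => by simp [hf n, hg n]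
      zero_mem' := fun n => by simp
      smul_mem' := fun a f hf n => by simp [hf n]
      lie_mem := fun {x f} hf n => key f 0 (fun n => by rw [hf n, zero_smul]) x n }
  obtain ⟨f, hf⟩ := (π : M →ₗ[F] N).exists_rightInverse_of_surjective
    (LinearMap.range_eq_top.mpr hπ)
  have hf' (n : N) : π (f n) = n := LinearMap.congr_fun hf n
  obtain ⟨⟨w, c, hc⟩, hw, hinv⟩ := exists_invariant_notMem (F := F) (𝔤 := 𝔤) _ W rfl
    (V.comap W.incl) (fun x w n => by
      obtain ⟨c, hc⟩ := w.2
      exact key w c hc x n)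
    (fun h => by
      have : (⟨f, 1, fun n => by rw [hf', one_smul]⟩ : W) ∈ V.comap W.incl :=
        h ▸ LieSubmodule.mem_top _
      obtain ⟨n, hn⟩ := exists_ne (0 : N)
      exact hn ((hf' n).symm.trans (this n)))
  have hc0 : c ≠ 0 := by
    rintro rfl
    exact hw fun n => (hc n).trans (zero_smul _ _)
  have hlie (x : 𝔤) (n : N) : w ⁅x, n⁆ = ⁅x, w n⁆ := by
    have h1 : ⁅x, w⁆ = 0 := congrArg Subtype.val (hinv x)
    have h2 := LinearMap.congr_fun h1 n
    rw [LieHom.lie_apply, LinearMap.zero_apply, sub_eq_zero] at h2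
    exact h2.symm
  exact ⟨{ c⁻¹ • w with map_lie' := fun {x n} => by simp [hlie] }, fun n => by
    change π (c⁻¹ • w n) = n
    rw [map_smul, hc, inv_smul_smul₀ hc0]⟩

end Weyl

/-! ### Leibniz kernel, simplicity and isomorphisms -/

section Structure

variable {F L : Type*} [Field F] [NonUnitalNonAssocRing L] [Module F L]

theorem mul_self_mem_leib (x : L) : x * x ∈ leib F L :=
  Submodule.subset_span ⟨x, rfl⟩

theorem mul_mem_derived (x y : L) : x * y ∈ derived F L :=
  Submodule.subset_span ⟨(x, y), rfl⟩

theorem leib_le_derived : leib F L ≤ derived F L :=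
  Submodule.span_le.mpr <| by rintro _ ⟨x, rfl⟩; exact mul_mem_derived x x

theorem leib_eq_bot_iff : leib F L = ⊥ ↔ ∀ x : L, x * x = 0 := by
  simp [leib, Submodule.span_eq_bot]

theorem IsSimple.exists_mul_ne_zero (h : IsSimple F L) : ∃ x y : L, x * y ≠ 0 := by
  by_contra! h0
  have hd : derived F L = ⊥ := by
    rw [derived, Submodule.span_eq_bot]
    rintro _ ⟨p, rfl⟩
    exact h0 _ _
  exact not_lt_bot (hd ▸ h.leib_lt_derived)

theorem IsIdeal.comap {A : Type*} [NonUnitalNonAssocRing A] [Module F A]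
    {I : Submodule F A} (hI : IsIdeal I) (e : L →ₗ[F] A)
    (he : ∀ x y, e (x * y) = e x * e y) : IsIdeal (I.comap e) := fun x a ha => by
  simpa [he] using hI (e x) (e a) ha

theorem IsSimple.of_equiv {A : Type*} [NonUnitalNonAssocRing A] [Module F A] (h : IsSimple F A)
    (e : L ≃ₗ[F] A) (he : ∀ x y, e (x * y) = e x * e y) : IsSimple F L := by
  have he' (x y : A) : e.symm (x * y) = e.symm x * e.symm y := by
    apply e.injective
    simp [he]
  have hl : (leib F L).map (e : L →ₗ[F] A) = leib F A := by
    rw [leib, leib, Submodule.map_span]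
    congr 1
    ext y
    constructor
    · rintro ⟨_, ⟨x, rfl⟩, rfl⟩
      exact ⟨e x, (he x x).symm⟩
    · rintro ⟨x, rfl⟩
      exact ⟨_, ⟨e.symm x, rfl⟩, by simp [he]⟩
  refine ⟨fun I hI => ?_, leib_le_derived.lt_of_ne fun hd => ?_⟩
  · have := h.ideals _ (hI.comap (e.symm : A →ₗ[F] L) he')
    rw [← Submodule.map_equiv_eq_comap_symm, ← hl] at this
    simpa [(Submodule.map_injective_of_injective e.injective).eq_iff] using this
  · refine h.leib_lt_derived.not_ge (Submodule.span_le.mpr ?_)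
    rintro _ ⟨⟨x, y⟩, rfl⟩
    change x * y ∈ leib F A
    rw [← hl]
    refine ⟨e.symm x * e.symm y, ?_, by simp [he]⟩
    rw [SetLike.mem_coe, hd]
    exact mul_mem_derived _ _

variable [IsLeftLeibniz L]

theorem mul_eq_zero_of_mem_leib [IsScalarTower F L L] {m : L} (hm : m ∈ leib F L) (x : L) : m * x = 0 := by
  induction hm using Submodule.span_induction with
  | mem m h =>
    obtain ⟨y, rfl⟩ := h
    simpa using IsLeftLeibniz.leibniz y y x
  | zero => simp
  | add a b _ _ ha hb => rw [add_mul, ha, hb, add_zero]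
  | smul c a _ ha => rw [smul_mul_assoc, ha, smul_zero]

variable [SMulCommClass F L L]

/-- Simplicity as a Lie algebra, in terms of the multiplication alone. -/
theorem isSimpleLie_iff : IsSimpleLie F L ↔ (∀ x : L, x * x = 0) ∧
    (∀ I : Submodule F L, IsIdeal I → I = ⊥ ∨ I = ⊤) ∧ ∃ x y : L, x * y ≠ 0 := by
  constructor
  · rintro ⟨h, hs⟩
    let _ := lieRingOfSq h
    let _ := lieAlgebraOfSq F h
    refine ⟨h, fun I hI => ?_, ?_⟩
    · let J : LieIdeal F L := { I with lie_mem := fun {x m} hm => (hI x m hm).1 }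
      have hJ : J.toSubmodule = I := rfl
      rcases hs.eq_bot_or_eq_top J with hb | ht
      · exact Or.inl (by rw [← hJ, hb, LieSubmodule.bot_toSubmodule])
      · exact Or.inr (by rw [← hJ, ht, LieSubmodule.top_toSubmodule])
    · by_contra! h0
      exact hs.non_abelian ⟨h0⟩
  · rintro ⟨h, hI, x, y, hxy⟩
    let _ := lieRingOfSq h
    let _ := lieAlgebraOfSq F h
    refine ⟨h, ⟨fun J => ?_, fun ha => hxy (ha.trivial x y)⟩⟩
    have hJ : IsIdeal J.toSubmodule := fun x a hx =>
      ⟨J.lie_mem hx, by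
        have : a * x = -(x * a) := (lie_skew a x).symm
        rw [this]
        exact neg_mem (J.lie_mem (x := x) hx)⟩
    simpa using hI J.toSubmodule hJ

theorem IsSimpleLie.isSimple (h : IsSimpleLie F L) : IsSimple F L := by
  obtain ⟨hsq, hI, x, y, hxy⟩ := isSimpleLie_iff.mp h
  have hb : leib F L = ⊥ := leib_eq_bot_iff.mpr hsq
  refine ⟨fun I hI' => (hI I hI').imp_right Or.inr, ?_⟩
  rw [hb, bot_lt_iff_ne_bot]
  intro hd
  exact hxy (by simpa [hd] using mul_mem_derived (F := F) x y)

theorem IsSimpleLie.of_equiv {A : Type*} [NonUnitalNonAssocRing A] [Module F A]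
    [SMulCommClass F A A] [IsLeftLeibniz A] (h : IsSimpleLie F A)
    (e : L ≃ₗ[F] A) (he : ∀ x y, e (x * y) = e x * e y) : IsSimpleLie F L := by
  have he' (x y : A) : e.symm (x * y) = e.symm x * e.symm y := by
    apply e.injective
    simp [he]
  rw [isSimpleLie_iff] at h ⊢
  obtain ⟨hsq, hI, x, y, hxy⟩ := h
  refine ⟨fun x => e.injective (by rw [he, hsq, map_zero]), fun I h => ?_, e.symm x, e.symm y, ?_⟩
  · have := hI _ (h.comap (e.symm : A →ₗ[F] L) he')
    rw [← Submodule.map_equiv_eq_comap_symm] at this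
    simpa using this
  · rw [← he']
    simpa using hxy

end Structure

/-! ### Hemi-semidirect products -/

section Hemi

/-- The pair `(x, m)`, as an element of the hemi-semidirect product. -/
def HemiSemidirect.mk {𝔤 M : Type*} (x : 𝔤) (m : M) : HemiSemidirect 𝔤 M := (x, m)

variable {F 𝔤 M : Type*} [Field F] [LieRing 𝔤] [LieAlgebra F 𝔤] [AddCommGroup M] [Module F M]
  [LieRingModule 𝔤 M]

theorem HemiSemidirect.mk_mul_mk (x y : 𝔤) (m n : M) :
    (HemiSemidirect.mk x m) * (HemiSemidirect.mk y n) = HemiSemidirect.mk ⁅x, y⁆ ⁅x, n⁆ := rfl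

/-- The squares are the elements `(0, x · m)`. They span a submodule of `M`, which is non-zero as the
action is non-trivial. -/
theorem HemiSemidirect.leib_eq (hM : LieModule.IsIrreducible F 𝔤 M)
    (hnt : ¬ LieModule.IsTrivial 𝔤 M) :
    leib F (HemiSemidirect 𝔤 M) = LinearMap.range (LinearMap.inr F 𝔤 M) := by
  have hprod (x : 𝔤) (m : M) : HemiSemidirect.mk 0 ⁅x, m⁆ ∈ leib F (HemiSemidirect 𝔤 M) := by
    have h := mul_self_mem_leib (F := F) (HemiSemidirect.mk x m)
    rwa [HemiSemidirect.mk_mul_mk, lie_self] at h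
  apply le_antisymm
  · refine Submodule.span_le.mpr ?_
    rintro _ ⟨p, rfl⟩
    exact ⟨⁅p.1, p.2⁆, by
      change ((0, _) : 𝔤 × M) = (⁅p.1, p.1⁆, _)
      rw [lie_self]
      rfl⟩
  · let N : LieSubmodule F 𝔤 M :=
      { (leib F (HemiSemidirect 𝔤 M)).comap (LinearMap.inr F 𝔤 M) with
        lie_mem := fun {x m} _ => hprod x m }
    have hN : N = ⊤ := (hM.eq_bot_or_eq_top N).resolve_left fun hb => hnt ⟨fun x m => by
      have : ⁅x, m⁆ ∈ N := hprod x m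
      simpa [hb] using this⟩
    rintro _ ⟨m, rfl⟩
    exact hN.ge (LieSubmodule.mem_top m)

theorem HemiSemidirect.isSimple [LieModule F 𝔤 M] (h𝔤 : LieAlgebra.IsSimple F 𝔤)
    (hM : LieModule.IsIrreducible F 𝔤 M)
    (hnt : ¬ LieModule.IsTrivial 𝔤 M) : IsSimple F (HemiSemidirect 𝔤 M) := by
  have hl := HemiSemidirect.leib_eq hM hnt
  refine ⟨fun I hI => ?_, leib_le_derived.lt_of_ne fun hd => ?_⟩
  · let J : LieIdeal F 𝔤 :=
      { I.map (LinearMap.fst F 𝔤 M) with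
        lie_mem := by
          rintro x _ ⟨p, hp, rfl⟩
          exact ⟨_, (hI (HemiSemidirect.mk x 0) p hp).1, rfl⟩ }
    let N : LieSubmodule F 𝔤 M :=
      { I.comap (LinearMap.inr F 𝔤 M) with
        lie_mem := fun {x m} hm => by
          have h := (hI (HemiSemidirect.mk x 0) (HemiSemidirect.mk 0 m) hm).1
          rwa [HemiSemidirect.mk_mul_mk, lie_zero] at h }
    -- `J` is the projection of `I` to `𝔤`, and `N` its intersection with `M`.
    rcases h𝔤.eq_bot_or_eq_top J with hJ | hJ
    · have hfst (p : 𝔤 × M) (hp : p ∈ I) : p.1 = 0 := by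
        have : p.1 ∈ J := ⟨p, hp, rfl⟩
        simpa [hJ] using this
      rcases hM.eq_bot_or_eq_top N with hN | hN
      · refine Or.inl ((Submodule.eq_bot_iff _).mpr ?_)
        rintro ⟨x, m⟩ hp
        obtain rfl : x = 0 := hfst _ hp
        have : m ∈ N := hp
        rw [hN, LieSubmodule.mem_bot] at this
        rw [this]
        rfl
      · refine Or.inr (Or.inl ?_)
        rw [hl]
        apply le_antisymm
        · rintro ⟨x, m⟩ hp
          obtain rfl : x = 0 := hfst _ hp
          exact ⟨m, rfl⟩
        · rintro _ ⟨m, rfl⟩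
          exact hN.ge (LieSubmodule.mem_top m)
    · have hmem (x : 𝔤) : ∃ m : M, HemiSemidirect.mk x m ∈ I := by
        obtain ⟨p, hp, rfl⟩ := hJ.ge (LieSubmodule.mem_top x)
        exact ⟨p.2, hp⟩
      have hlie (x : 𝔤) (m : M) : ⁅x, m⁆ ∈ N := by
        obtain ⟨m', h'⟩ := hmem x
        have h := (hI (HemiSemidirect.mk 0 m) _ h').2
        rwa [HemiSemidirect.mk_mul_mk, lie_zero] at h
      have hN : N = ⊤ := (hM.eq_bot_or_eq_top N).resolve_left fun hb =>
        hnt ⟨fun x m => by simpa [hb] using hlie x m⟩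
      refine Or.inr (Or.inr (Submodule.eq_top_iff'.mpr ?_))
      rintro ⟨x, m⟩
      obtain ⟨m', h'⟩ := hmem x
      have h : ((0, m - m') : 𝔤 × M) ∈ I := hN.ge (LieSubmodule.mem_top (m - m'))
      have hs := add_mem h' h
      have e : ((x, m') : 𝔤 × M) + (0, m - m') = (x, m) := by simp
      exact e ▸ hs
  · refine h𝔤.non_abelian ⟨fun x y => ?_⟩
    have h := mul_mem_derived (F := F) (HemiSemidirect.mk x (0 : M)) (HemiSemidirect.mk y 0)
    rw [← hd, hl] at h
    obtain ⟨m, hm⟩ := h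
    exact (congrArg Prod.fst hm).symm

end Hemi

/-! ### The Lie algebra of left multiplications -/

section LeftMul

attribute [local instance] LieRing.ofAssociativeRing

variable (F L : Type*) [Field F] [NonUnitalNonAssocRing L] [Module F L] [IsScalarTower F L L]
  [SMulCommClass F L L] [IsLeftLeibniz L]

/-- The Lie algebra of left multiplication operators of `L`. For simple `L` it is a model of the
quotient `L / Leib(L)`, and it acts on `L` by construction. -/
def leftMul : LieSubalgebra F (Module.End F L) :=
  { LinearMap.range (LinearMap.mul F L) with
    lie_mem' := by
      rintro _ _ ⟨x, rfl⟩ ⟨y, rfl⟩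
      refine ⟨x * y, LinearMap.ext fun z => ?_⟩
      rw [LieRing.of_associative_ring_bracket]
      simp [IsLeftLeibniz.leibniz x y z] }

/-- The map `x ↦ (y ↦ x * y)`, as a homomorphism of modules over the Lie algebra of left
multiplications. -/
def toLeftMul : L →ₗ⁅F, leftMul F L⁆ leftMul F L :=
  { (LinearMap.mul F L).rangeRestrict with
    map_lie' := by
      rintro ⟨_, x, rfl⟩ y
      refine Subtype.ext (LinearMap.ext fun z => ?_)
      change (x * y) * z = x * (y * z) - y * (x * z)
      rw [IsLeftLeibniz.leibniz x y z, add_sub_cancel_right] }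

variable {F L}

theorem toLeftMul_surjective : Function.Surjective (toLeftMul F L) :=
  (LinearMap.mul F L).surjective_rangeRestrict

theorem toLeftMul_lie (x y : L) : ⁅toLeftMul F L x, y⁆ = x * y := rfl

theorem toLeftMul_mul (x y : L) : toLeftMul F L (x * y) = ⁅toLeftMul F L x, toLeftMul F L y⁆ :=
  (toLeftMul F L).map_lie (toLeftMul F L x) y

theorem toLeftMul_eq_zero_iff {x : L} : toLeftMul F L x = 0 ↔ ∀ y, x * y = 0 := by
  constructor
  · intro h y
    rw [← toLeftMul_lie (F := F), h, zero_lie]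
  · exact fun h => Subtype.ext (LinearMap.ext h)

/-- The left annihilator of `L` is an ideal that contains `Leib(L)`, and a proper one since `L² ≠ 0`. -/
theorem IsSimple.toLeftMul_eq_zero_iff (h : IsSimple F L) {x : L} :
    toLeftMul F L x = 0 ↔ x ∈ leib F L := by
  refine ⟨fun hx => ?_, fun hx => LeibnizAlg.toLeftMul_eq_zero_iff.mpr (mul_eq_zero_of_mem_leib hx)⟩
  have hI : IsIdeal (LinearMap.ker (toLeftMul F L : L →ₗ[F] leftMul F L)) := fun x a ha => by
    have ha : toLeftMul F L a = 0 := ha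
    constructor
    · change toLeftMul F L (x * a) = 0
      rw [toLeftMul_mul, ha, lie_zero]
    · change toLeftMul F L (a * x) = 0
      rw [toLeftMul_mul, ha, zero_lie]
  rcases h.ideals _ hI with hb | hl | ht
  · have : x ∈ LinearMap.ker (toLeftMul F L : L →ₗ[F] leftMul F L) := hx
    rw [hb, Submodule.mem_bot] at this
    exact this ▸ zero_mem _
  · exact hl.le hx
  · obtain ⟨x, y, hxy⟩ := h.exists_mul_ne_zero
    have : toLeftMul F L x = 0 := ht.ge (Submodule.mem_top (x := x))
    exact absurd (LeibnizAlg.toLeftMul_eq_zero_iff.mp this y) hxy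

theorem IsSimple.leftMul_isSimple (h : IsSimple F L) : LieAlgebra.IsSimple F (leftMul F L) where
  eq_bot_or_eq_top J := by
    have hI : IsIdeal (J.toSubmodule.comap (toLeftMul F L : L →ₗ[F] leftMul F L)) := fun x a ha => by
      have ha : toLeftMul F L a ∈ J := ha
      constructor
      · change toLeftMul F L (x * a) ∈ J
        rw [toLeftMul_mul]
        exact J.lie_mem ha
      · change toLeftMul F L (a * x) ∈ J
        rw [toLeftMul_mul]
        exact lie_mem_left F _ J _ _ ha
    have hJ (hle : J.toSubmodule.comap (toLeftMul F L : L →ₗ[F] leftMul F L) ≤ leib F L) :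
        J = ⊥ := by
      rw [LieSubmodule.eq_bot_iff]
      intro y hy
      obtain ⟨x, rfl⟩ := toLeftMul_surjective y
      exact h.toLeftMul_eq_zero_iff.mpr (hle hy)
    rcases h.ideals _ hI with hb | hl | ht
    · exact Or.inl (hJ (hb ▸ bot_le))
    · exact Or.inl (hJ hl.le)
    · refine Or.inr (LieSubmodule.ext_iff.mpr fun y => ?_)
      obtain ⟨x, rfl⟩ := toLeftMul_surjective y
      exact ⟨fun _ => LieSubmodule.mem_top _, fun _ => ht.ge (Submodule.mem_top (x := x))⟩
  non_abelian := fun ha => h.leib_lt_derived.not_ge (Submodule.span_le.mpr <| by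
    rintro _ ⟨⟨x, y⟩, rfl⟩
    refine h.toLeftMul_eq_zero_iff.mp ?_
    rw [toLeftMul_mul, ha.trivial])

/-- Levi decomposition of a simple Leibniz algebra: the image of a module section of `toLeftMul` is
stable under all left multiplications, hence a subalgebra, and it complements the kernel
`Leib(L)`. -/
theorem IsSimple.exists_isCompl_leib [CharZero F] [FiniteDimensional F L] (h : IsSimple F L) :
    ∃ g : NonUnitalSubalgebra F L, IsCompl g.toSubmodule (leib F L) := by
  have := h.leftMul_isSimple
  obtain ⟨s, hs⟩ := exists_lieModuleHom_section (toLeftMul F L) toLeftMul_surjective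
  have hsl : ∀ x, x ∈ LinearMap.range (s : leftMul F L →ₗ[F] L) ↔ s (toLeftMul F L x) = x := by
    refine fun x => ⟨?_, fun hx => ⟨_, hx⟩⟩
    rintro ⟨y, rfl⟩
    exact congrArg s (hs y)
  refine ⟨{ LinearMap.range (s : leftMul F L →ₗ[F] L) with
    mul_mem' := ?_ }, ?_⟩
  · rintro x _ _ ⟨y, rfl⟩
    exact ⟨⁅toLeftMul F L x, y⁆, s.map_lie _ _⟩
  · change IsCompl (LinearMap.range (s : leftMul F L →ₗ[F] L)) (leib F L)
    constructor
    · rw [Submodule.disjoint_def]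
      intro x hx hx'
      rw [← (hsl x).mp hx, h.toLeftMul_eq_zero_iff.mpr hx', map_zero]
    · rw [codisjoint_iff, Submodule.eq_top_iff']
      intro x
      refine Submodule.mem_sup.mpr ⟨s (toLeftMul F L x), ⟨_, rfl⟩, x - s (toLeftMul F L x), ?_,
        add_sub_cancel _ _⟩
      rw [← h.toLeftMul_eq_zero_iff, map_sub, hs, sub_self]

end LeftMul

/-! ### Complements of the Leibniz kernel -/

section Complement

variable {F L : Type*} [Field F] [NonUnitalNonAssocRing L] [Module F L]
  {g : NonUnitalSubalgebra F L}

theorem exists_add_of_isCompl (hg : IsCompl g.toSubmodule (leib F L)) (x : L) :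
    ∃ a ∈ g, ∃ m ∈ leib F L, a + m = x :=
  Submodule.mem_sup.mp (hg.sup_eq_top ▸ Submodule.mem_top (x := x))

theorem mul_self_eq_zero_of_isCompl (hg : IsCompl g.toSubmodule (leib F L)) {x : L} (hx : x ∈ g) :
    x * x = 0 :=
  Submodule.disjoint_def.mp hg.disjoint _ (g.mul_mem hx hx) (mul_self_mem_leib x)

variable [IsScalarTower F L L] [SMulCommClass F L L] [IsLeftLeibniz L]

theorem leibBimodule_isAntisymmetric : (leibBimodule g).IsAntisymmetric :=
  fun x m => Subtype.ext (mul_eq_zero_of_mem_leib m.2 (x : L))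

theorem IsSimple.isSimpleLie_of_isCompl (h : IsSimple F L)
    (hg : IsCompl g.toSubmodule (leib F L)) : IsSimpleLie F g := by
  rw [isSimpleLie_iff]
  refine ⟨fun x => Subtype.ext (mul_self_eq_zero_of_isCompl hg x.2), fun I hI => ?_, ?_⟩
  · have hmem {x : L} : x ∈ I.map g.toSubmodule.subtype ↔ ∃ hx : x ∈ g, (⟨x, hx⟩ : g) ∈ I := by
      constructor
      · rintro ⟨y, hy, rfl⟩
        exact ⟨y.2, hy⟩
      · rintro ⟨hx, h⟩
        exact ⟨_, h, rfl⟩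
    -- An ideal `I` of `g` gives the ideal `I + Leib(L)` of `L`.
    have hJ : IsIdeal (I.map g.toSubmodule.subtype ⊔ leib F L) := by
      intro x b hb
      obtain ⟨a, ha, n, hn, rfl⟩ := Submodule.mem_sup.mp hb
      obtain ⟨y, hy, m, hm, rfl⟩ := exists_add_of_isCompl hg x
      obtain ⟨hag, haI⟩ := hmem.mp ha
      have hyg := hI ⟨y, hy⟩ _ haI
      have hL := isIdeal_leib (F := F) (L := L)
      constructor
      · rw [add_mul, mul_eq_zero_of_mem_leib hm, add_zero, mul_add]
        exact Submodule.add_mem_sup (hmem.mpr ⟨g.mul_mem hy hag, hyg.1⟩) (hL _ _ hn).1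
      · rw [add_mul, mul_eq_zero_of_mem_leib hn, add_zero, mul_add]
        exact Submodule.add_mem_sup (hmem.mpr ⟨g.mul_mem hag hy, hyg.2⟩) (hL _ _ hm).1
    have hle : I.map g.toSubmodule.subtype ≤ g.toSubmodule := Submodule.map_subtype_le _ _
    have hbot (hb : I.map g.toSubmodule.subtype ≤ leib F L) : I = ⊥ := by
      rw [Submodule.eq_bot_iff]
      intro x hx
      exact Subtype.ext (Submodule.disjoint_def.mp hg.disjoint _ x.2 (hb ⟨x, hx, rfl⟩))
    rcases h.ideals _ hJ with hb | hl | ht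
    · exact Or.inl (hbot (le_sup_left.trans (hb ▸ bot_le)))
    · exact Or.inl (hbot (le_sup_left.trans hl.le))
    · refine Or.inr (Submodule.eq_top_iff'.mpr fun x => ?_)
      obtain ⟨a, ha, n, hn, hx⟩ := Submodule.mem_sup.mp (ht.ge (Submodule.mem_top (x := (x : L))))
      have hn0 : n = 0 := Submodule.disjoint_def.mp hg.disjoint _ (by
        rw [← add_sub_cancel_left a n, hx]
        exact sub_mem x.2 (hle ha)) hn
      rw [hn0, add_zero] at hx
      obtain ⟨_, h⟩ := hmem.mp (hx ▸ ha)
      exact h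
  · by_contra! h0
    refine h.leib_lt_derived.not_ge (Submodule.span_le.mpr ?_)
    rintro _ ⟨⟨x, y⟩, rfl⟩
    obtain ⟨a, ha, m, hm, rfl⟩ := exists_add_of_isCompl hg x
    obtain ⟨b, hb, n, hn, rfl⟩ := exists_add_of_isCompl hg y
    have hab : a * b = 0 := congrArg Subtype.val (h0 ⟨a, ha⟩ ⟨b, hb⟩)
    change (a + m) * (b + n) ∈ leib F L
    rw [add_mul, mul_eq_zero_of_mem_leib hm, add_zero, mul_add, hab, zero_add]
    exact (isIdeal_leib _ _ hn).1

/-- If `a · m = 0` for `a ∈ g` and `m ∈ Leib(L)`, all squares `(a + m)(a + m) = a * m` vanish. -/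
theorem leibBimodule_not_isTrivial (hg : IsCompl g.toSubmodule (leib F L)) (hl : leib F L ≠ ⊥) :
    ¬ (leibBimodule g).IsTrivial := by
  refine fun ht => hl (leib_eq_bot_iff.mpr fun x => ?_)
  obtain ⟨a, ha, m, hm, rfl⟩ := exists_add_of_isCompl hg x
  have h : a * m = 0 := congrArg Subtype.val (ht ⟨a, ha⟩ ⟨m, hm⟩).1
  rw [add_mul, mul_eq_zero_of_mem_leib hm, add_zero, mul_add, h, add_zero,
    mul_self_eq_zero_of_isCompl hg ha]

theorem IsSimple.leibBimodule_isIrreducible (h : IsSimple F L)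
    (hg : IsCompl g.toSubmodule (leib F L)) (hl : leib F L ≠ ⊥) :
    (leibBimodule g).IsIrreducible := by
  refine ⟨Submodule.nontrivial_iff_ne_bot.mpr hl, fun N hN => ?_⟩
  have hI : IsIdeal (N.map (leib F L).subtype) := by
    rintro x _ ⟨m, hm, rfl⟩
    obtain ⟨a, ha, n, hn, rfl⟩ := exists_add_of_isCompl hg x
    constructor
    · rw [add_mul, mul_eq_zero_of_mem_leib hn, add_zero]
      exact ⟨_, (hN ⟨a, ha⟩ m hm).1, rfl⟩
    · rw [Submodule.subtype_apply, mul_eq_zero_of_mem_leib m.2]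
      exact zero_mem _
  have htop (hle : leib F L ≤ N.map (leib F L).subtype) : N = ⊤ := by
    refine Submodule.eq_top_iff'.mpr fun x => ?_
    obtain ⟨y, hy, hyx⟩ := hle x.2
    exact Subtype.ext hyx ▸ hy
  rcases h.ideals _ hI with hb | hl | ht
  · exact Or.inl (Submodule.map_injective_of_injective (leib F L).injective_subtype
      (hb.trans (Submodule.map_bot _).symm))
  · exact Or.inr (htop hl.ge)
  · exact Or.inr (htop (ht ▸ le_top))

/-- If `g` complements `Leib(L)`, then `(a + m)(b + n) = ab + an` for `a, b ∈ g` and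
`m, n ∈ Leib(L)`, which is the multiplication of the hemi-semidirect product of `g` and `Leib(L)`. -/
theorem exists_iso_hemiSemidirect {F : Type v} {L : Type u} [Field F] [NonUnitalNonAssocRing L]
    [Module F L] [IsScalarTower F L L]
    [SMulCommClass F L L] [IsLeftLeibniz L] {g : NonUnitalSubalgebra F L}
    [FiniteDimensional F g] [FiniteDimensional F (leib F L)] (hs : IsSimpleLie F g)
    (hg : IsCompl g.toSubmodule (leib F L)) (hnt : ¬ (leibBimodule g).IsTrivial)
    (hirr : (leibBimodule g).IsIrreducible) :
    ∃ (𝔤 M : Type u) (_ : LieRing 𝔤) (_ : LieAlgebra F 𝔤)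
      (_ : AddCommGroup M) (_ : Module F M) (_ : LieRingModule 𝔤 M) (_ : LieModule F 𝔤 M),
      FiniteDimensional F 𝔤 ∧ LieAlgebra.IsSimple F 𝔤 ∧
      FiniteDimensional F M ∧ LieModule.IsIrreducible F 𝔤 M ∧ ¬ LieModule.IsTrivial 𝔤 M ∧
      IsIso F L (HemiSemidirect 𝔤 M) := by
  obtain ⟨hsq, hsimple⟩ := hs
  let iR : LieRing g := lieRingOfSq hsq
  let iA : LieAlgebra F g := lieAlgebraOfSq F hsq
  let B := leibBimodule g
  let iM : LieRingModule g (leib F L) :=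
    { bracket := fun x m => B.left x m
      add_lie := fun x y m => by
        change B.left (x + y) m = B.left x m + B.left y m
        simp
      lie_add := fun x m n => (B.left x).map_add m n
      leibniz_lie := fun x y m => by
        change B.left x (B.left y m) = B.left (x * y) m + B.left y (B.left x m)
        rw [B.llm, sub_add_cancel] }
  let iLM : LieModule F g (leib F L) :=
    { smul_lie := fun c x m => by
        change B.left (c • x) m = c • B.left x m
        simp
      lie_smul := fun c x m => (B.left x).map_smul c m }
  have hlie (x : g) (m : leib F L) : ((⁅x, m⁆ : leib F L) : L) = x * m := rfl
  refine ⟨g, leib F L, iR, iA, inferInstance, inferInstance, iM, iLM, inferInstance, hsimple,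
    inferInstance, ?_, ?_, ?_⟩
  · have := hirr.1
    refine LieModule.IsIrreducible.mk fun N hN => ?_
    have hsub : B.IsSubbimodule N.toSubmodule := fun x m hm =>
      ⟨N.lie_mem (x := x) hm, by
        rw [leibBimodule_isAntisymmetric x m]
        exact zero_mem _⟩
    have := hirr.2 _ hsub
    simpa [hN] using this
  · exact fun ht => hnt fun x m => ⟨ht.trivial x m, leibBimodule_isAntisymmetric x m⟩
  · let e := Submodule.prodEquivOfIsCompl g.toSubmodule (leib F L) hg
    let e' : HemiSemidirect g (leib F L) ≃ₗ[F] L := e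
    have he (p : HemiSemidirect g (leib F L)) : e' p = (p.1 : L) + (p.2 : L) := rfl
    have hmul (p q) : e' (p * q) = e' p * e' q := by
      rw [he, he, he, HemiSemidirect.mul_def, add_mul, mul_eq_zero_of_mem_leib p.2.2, add_zero,
        mul_add]
      rfl
    exact ⟨e'.symm, fun x y => e'.injective (by simp [hmul])⟩

end Complement

end LeibnizAlg

theorem theorem3p3 (F : Type v) [Field F] [CharZero F]
    (L : Type u) [NonUnitalNonAssocRing L] [Module F L] [IsScalarTower F L L]
    [SMulCommClass F L L] [LeibnizAlg.IsLeftLeibniz L] :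
    List.TFAE [
      FiniteDimensional F L ∧ LeibnizAlg.IsSimple F L,
      ∃ g : NonUnitalSubalgebra F L,
        FiniteDimensional F g ∧ LeibnizAlg.IsSimpleLie F g ∧
        IsCompl g.toSubmodule (LeibnizAlg.leib F L) ∧
        (LeibnizAlg.leib F L = ⊥ ∨
          (¬ (LeibnizAlg.leibBimodule g).IsTrivial ∧
            FiniteDimensional F (LeibnizAlg.leib F L) ∧
            (LeibnizAlg.leibBimodule g).IsIrreducible ∧
            (LeibnizAlg.leibBimodule g).IsAntisymmetric)),
      (FiniteDimensional F L ∧ LeibnizAlg.IsSimpleLie F L) ∨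
        ∃ (𝔤 M : Type u) (_ : LieRing 𝔤) (_ : LieAlgebra F 𝔤)
          (_ : AddCommGroup M) (_ : Module F M) (_ : LieRingModule 𝔤 M) (_ : LieModule F 𝔤 M),
          FiniteDimensional F 𝔤 ∧ LieAlgebra.IsSimple F 𝔤 ∧
          FiniteDimensional F M ∧ LieModule.IsIrreducible F 𝔤 M ∧ ¬ LieModule.IsTrivial 𝔤 M ∧
          LeibnizAlg.IsIso F L (LeibnizAlg.HemiSemidirect 𝔤 M)] := by
  tfae_have 1 → 2 := by
    rintro ⟨_, h⟩
    obtain ⟨g, hg⟩ := h.exists_isCompl_leib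
    refine ⟨g, inferInstanceAs (FiniteDimensional F g.toSubmodule), h.isSimpleLie_of_isCompl hg,
      hg, ?_⟩
    by_cases hl : LeibnizAlg.leib F L = ⊥
    · exact Or.inl hl
    · exact Or.inr ⟨LeibnizAlg.leibBimodule_not_isTrivial hg hl, inferInstance,
        h.leibBimodule_isIrreducible hg hl, LeibnizAlg.leibBimodule_isAntisymmetric⟩
  tfae_have 2 → 3 := by
    rintro ⟨g, _, hs, hg, hl | ⟨hnt, _, hirr, -⟩⟩
    · have htop : g.toSubmodule = ⊤ := by simpa [hl] using hg.sup_eq_top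
      let e : L ≃ₗ[F] g := (LinearEquiv.ofTop g.toSubmodule htop).symm
      have := Module.Finite.equiv e.symm
      exact Or.inl ⟨inferInstance, hs.of_equiv e fun x y => rfl⟩
    · exact Or.inr (LeibnizAlg.exists_iso_hemiSemidirect hs hg hnt hirr)
  tfae_have 3 → 1 := by
    rintro (⟨hf, hs⟩ | ⟨𝔤, M, _, _, _, _, _, _, _, h𝔤, _, hM, hnt, e, he⟩)
    · exact ⟨hf, hs.isSimple⟩
    · have : FiniteDimensional F (LeibnizAlg.HemiSemidirect 𝔤 M) :=
        inferInstanceAs (FiniteDimensional F (𝔤 × M))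
      exact ⟨Module.Finite.equiv e.symm, (LeibnizAlg.HemiSemidirect.isSimple h𝔤 hM hnt).of_equiv e he⟩
  tfae_finish
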